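/- Let $\mu$ be a positive Borel measure on $\mathbb R$ that is finite on compact sets and has no atoms, with $\mu([0,\ell))>0$ for every $\ell>0$, and let $\mathfrak a:[0,\infty)\to\mathbb C$ be $\mu$-measurable with $|\mathfrak a|\le 1$ $\mu$-a.e. Put $$j=\begin{pmatrix}-1&0\\0&1\end{pmatrix},\qquad A=\begin{pmatrix}1&-\overline{\mathfrak a}\\-\mathfrak a&1\end{pmatrix},\qquad B=\begin{pmatrix}0&\overline{\mathfrak a}\\-\mathfrak a&0\end{pmatrix},$$ and let $\mathfrak A(z,\ell)$ be the transfer matrix of the canonical system in Arov gauge (A-gauge) with parameters $(\mu,\mathfrak a)$, i.e. the solution of $$\mathfrak A(z,\ell)\,j=j+\int_0^\ell \mathfrak A(z,l)\bigl(izA(l)-B(l)\bigr)\,d\mu(l),\qquad z\in\mathbb C,\ \ell\ge 0.$$ For $\operatorname{Im} z>0$ let $D(z,\ell)=\{w\in\mathbb C:\ (w\ \ 1)\,\mathfrak A(z,\ell)\,j\,\mathfrak A(z,\ell)^*\,(w\ \ 1)^*\ge 0\}$ be the Weyl disks. Assume that the system is in the limit point case, i.e. for every $z$ with $\operatorname{Im}z>0$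 the intersection $\bigcap_{\ell>0}D(z,\ell)$ consists of a single point, and let $s_+$ be the Schur function, defined by $\{s_+(z)\}=\bigcap_{\ell>0}D(z,\ell)$. If there is $\mathfrak a(0)\in\mathbb C$ such that $$\lim_{\ell\downarrow 0}\frac1{\mu([0,\ell))}\int_0^\ell|\mathfrak a(l)-\mathfrak a(0)|\,d\mu(l)=0,$$ then for every $\delta>0$ $$\lim_{\substack{z\to\infty\\ \arg z\in[\delta,\pi-\delta]}}s_+(z)=\frac{\mathfrak a(0)}{1+\sqrt{1-|\mathfrak a(0)|^2}}.$$ -/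

import Mathlib

open MeasureTheory Filter Topology Set
open scoped Matrix

noncomputable section

namespace ArovGauge

/-- The signature matrix `j = diag(-1, 1)`. -/
def jMat : Matrix (Fin 2) (Fin 2) ℂ := !![-1, 0; 0, 1]

/-- The coefficient `A ≥ 0` of an A-gauge system at a point where the parameter has value `a`. -/
def coeffA (a : ℂ) : Matrix (Fin 2) (Fin 2) ℂ := !![1, -star a; -a, 1]

/-- The skew-Hermitian coefficient `B` of an A-gauge system at a point where the parameter
has value `a`. -/
def coeffB (a : ℂ) : Matrix (Fin 2) (Fin 2) ℂ := !![0, star a; -a, 0]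

/-- `(μ, a)` are parameters of a canonical system in A-gauge on `[0, ∞)`: the positive measure `μ`
is finite on compact sets and has no atoms, and `a ∈ L^∞(μ)` with norm at most `1`. -/
structure IsParameters (μ : Measure ℝ) (a : ℝ → ℂ) : Prop where
  finite_on_compacts : ∀ K : Set ℝ, IsCompact K → μ K < ⊤
  no_atoms : ∀ x : ℝ, μ {x} = 0
  measurable : AEStronglyMeasurable a (μ.restrict (Ici 0))
  norm_le_one : ∀ᵐ l ∂(μ.restrict (Ici 0)), ‖a l‖ ≤ 1

/-- `𝔄` is the transfer matrix of the canonical system with parameters `(μ, a)`: for all `z ∈ ℂ` and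
`ℓ ≥ 0`, `𝔄(z,ℓ) j = j + ∫₀^ℓ 𝔄(z,l) (i z A(l) - B(l)) dμ(l)`, read entry by entry,
the integrand being integrable. -/
def IsTransferMatrix (μ : Measure ℝ) (a : ℝ → ℂ) (𝔄 : ℂ → ℝ → Matrix (Fin 2) (Fin 2) ℂ) : Prop :=
  ∀ (z : ℂ) (ℓ : ℝ), 0 ≤ ℓ → ∀ p q : Fin 2,
    IntervalIntegrable
      (fun l => (𝔄 z l * ((Complex.I * z) • coeffA (a l) - coeffB (a l))) p q) μ 0 ℓ ∧
    (𝔄 z ℓ * jMat) p q = jMat p q +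
      ∫ l in (0 : ℝ)..ℓ, (𝔄 z l * ((Complex.I * z) • coeffA (a l) - coeffB (a l))) p q ∂μ

/-- The Weyl disk `{w | (w 1) T j T* (w 1)* ≥ 0}` of a matrix `T`. The matrix `T j T*` is Hermitian,
so the quadratic form is real. -/
def weylDisk (T : Matrix (Fin 2) (Fin 2) ℂ) : Set ℂ :=
  {w | 0 ≤ ((![w, 1] ᵥ* (T * jMat * Tᴴ)) ⬝ᵥ star ![w, 1]).re}

/-- The family `𝔄` is in the limit point case and `s` is its Schur function `s₊` on the upper
half-plane: `{s₊(z)} = ⋂_{ℓ > 0} D(z,ℓ)`. -/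
def IsSchurFunction (𝔄 : ℂ → ℝ → Matrix (Fin 2) (Fin 2) ℂ) (s : ℂ → ℂ) : Prop :=
  ∀ z : ℂ, 0 < z.im → ⋂ ℓ ∈ Ioi (0 : ℝ), weylDisk (𝔄 z ℓ) = {s z}

end ArovGauge

end

/-!
Let `w = s₊(z)` and follow the row vector `v = (w 1) 𝔄(z, ·)` in the time `t = μ([0, ℓ))`. Up to
times of order `1 / |z|` it is, by Grönwall's inequality, uniformly close to the solution `V` of the
constant-coefficient system `V' = i z V A(a₀) j`: the term `B` contributes `O(t)`, and replacing `a`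
by `a₀` costs `|z| ∫ |a - a₀| dμ = o(1)`.

Put `σ = a₀ / (1 + √(1 - |a₀|²))`. Then `(1, -σ)` is an eigenvector of `A(a₀) j`, and `|V₀ - σ V₁|`
does not decrease in time when `Im z ≥ 0`. The form `V j V* = |V₁|² - |V₀|²` is at most `1` at the
start and decreases at the rate `2 Im z · V A V* ≥ Im z |V₀ - σ V₁|² ≥ Im z |w - σ|²`, whereas `w`
lying in the Weyl disks prevents it from dropping below `-o(1)`. Hence
`Im z · t · |w - σ|² ≤ 1 + o(1)` at `t = C / |z|`, which in a sector gives `|w - σ|² = O(1 / C)`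
with `C` arbitrarily large.
-/

namespace ArovGauge

section Cumul

variable {μ : Measure ℝ} {a b : ℝ}

/-- The distribution function of a measure on the line with base point `a`; it vanishes on
`(-∞, a]`. -/
noncomputable def cumul (μ : Measure ℝ) (a x : ℝ) : ℝ := μ.real (Ioc a x)

@[simp] lemma cumul_self : cumul μ a a = 0 := by simp [cumul]

lemma cumul_nonneg (x : ℝ) : 0 ≤ cumul μ a x := measureReal_nonneg

lemma cumul_eq_integral {x : ℝ} (hx : a ≤ x) : cumul μ a x = ∫ _ in a..x, (1 : ℝ) ∂μ := by
  simp [cumul, intervalIntegral.integral_of_le hx]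

variable [IsLocallyFiniteMeasure μ]

lemma monotone_cumul : Monotone (cumul μ a) := fun _ _ hxy =>
  measureReal_mono (Ioc_subset_Ioc_right hxy) measure_Ioc_lt_top.ne

variable [NullSingletonClass μ]

lemma continuous_cumul : Continuous (cumul μ a) := by
  have hmax : cumul μ a = fun x => ∫ _ in a..max a x, (1 : ℝ) ∂μ := by
    funext x
    rw [← cumul_eq_integral (le_max_left a x)]
    rcases le_total a x with h | h <;> simp [cumul, h]
  rw [hmax]
  exact (intervalIntegral.continuous_primitive (fun _ _ => intervalIntegrable_const) a).comp
    (continuous_const.max continuous_id)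

lemma exists_cumul_preimage_Iic_inter_Ioc (hab : a ≤ b) {t : ℝ} (ht : 0 ≤ t) :
    ∃ x, cumul μ a ⁻¹' Iic t ∩ Ioc a b = Ioc a x ∧ cumul μ a x = min (cumul μ a b) t := by
  obtain ⟨x, ⟨⟨hax, hxb⟩, hxt⟩, hmax⟩ :=
    (isCompact_Icc.inter_right (isClosed_Iic.preimage continuous_cumul) :
      IsCompact (Icc a b ∩ cumul μ a ⁻¹' Iic t)).exists_isGreatest ⟨a, by simp [hab, ht]⟩
  refine ⟨x, Subset.antisymm ?_ ?_, le_antisymm (le_min (monotone_cumul hxb) hxt) ?_⟩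
  · rintro y ⟨hyt, hay, hyb⟩
    exact ⟨hay, hmax ⟨⟨hay.le, hyb⟩, hyt⟩⟩
  · rintro y ⟨hay, hyx⟩
    exact ⟨(monotone_cumul hyx).trans hxt, hay, hyx.trans hxb⟩
  · by_contra! hlt
    obtain ⟨y, ⟨hxy, hyb⟩, hy⟩ := intermediate_value_Icc hxb continuous_cumul.continuousOn
      ⟨hlt.le, min_le_left (cumul μ a b) t⟩
    have hyx : y ≤ x := hmax ⟨⟨hax.trans hxy, hyb⟩, hy.trans_le (min_le_right _ _)⟩
    exact hlt.not_ge (hy.ge.trans (monotone_cumul hyx))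

lemma map_cumul_restrict_Ioc (hab : a ≤ b) :
    (μ.restrict (Ioc a b)).map (cumul μ a) = volume.restrict (Ioc 0 (cumul μ a b)) := by
  have hmeas := (continuous_cumul (μ := μ) (a := a)).measurable
  have : IsFiniteMeasure (μ.restrict (Ioc a b)) := ⟨by simp [measure_Ioc_lt_top]⟩
  refine Measure.ext_of_Iic _ _ fun t => ?_
  rw [Measure.map_apply hmeas measurableSet_Iic, Measure.restrict_apply (hmeas measurableSet_Iic),
    Measure.restrict_apply measurableSet_Iic, inter_comm (Iic t), Ioc_inter_Iic]
  rcases lt_or_ge t 0 with ht | ht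
  · have hempty : cumul μ a ⁻¹' Iic t = ∅ :=
      eq_empty_of_forall_notMem fun x hx => (ht.trans_le (cumul_nonneg x)).not_ge hx
    simp [hempty, ht.le]
  · obtain ⟨x, hset, hx⟩ := exists_cumul_preimage_Iic_inter_Ioc (μ := μ) hab ht
    rw [hset, ← hx, Real.volume_Ioc, sub_zero, cumul, ofReal_measureReal measure_Ioc_lt_top.ne]

theorem integral_comp_cumul {E : Type*} [NormedAddCommGroup E] [NormedSpace ℝ E] [CompleteSpace E]
    {F f : ℝ → E} (hF : ∀ t, HasDerivAt F (f t) t) (hf : Continuous f) (hab : a ≤ b) :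
    ∫ x in a..b, f (cumul μ a x) ∂μ = F (cumul μ a b) - F 0 := by
  rw [intervalIntegral.integral_of_le hab,
    ← intervalIntegral.integral_eq_sub_of_hasDerivAt (fun t _ => hF t)
      (hf.intervalIntegrable _ _),
    intervalIntegral.integral_of_le (cumul_nonneg b), ← map_cumul_restrict_Ioc hab,
    integral_map continuous_cumul.aemeasurable hf.aestronglyMeasurable]

lemma le_mul_exp_cumul_of_lt_of_le_add_integral {u : ℝ → ℝ} {c c' K : ℝ} (hab : a ≤ b)
    (hK : 0 ≤ K) (hu : ContinuousOn u (Icc a b))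
    (hle : ∀ x ∈ Icc a b, u x ≤ c + K * ∫ y in a..x, u y ∂μ) (hc : c < c') :
    u b ≤ c' * Real.exp (K * cumul μ a b) := by
  have hcont := continuous_cumul (μ := μ) (a := a)
  set w : ℝ → ℝ := fun x => c' * Real.exp (K * cumul μ a x) with hw
  have hwc : Continuous w := by fun_prop
  have hw_eq (x : ℝ) (hx : a ≤ x) : w x = c' + K * ∫ y in a..x, w y ∂μ := by
    have hF (t : ℝ) : HasDerivAt (fun t => c' * Real.exp (K * t)) (K * (c' * Real.exp (K * t))) t :=
      (((hasDerivAt_id' t).const_mul K).exp.const_mul c').congr_deriv (by ring)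
    rw [← intervalIntegral.integral_const_mul, integral_comp_cumul hF (by fun_prop) hx]
    simp [hw]
  -- At the first point where `u` reaches the barrier `w`, the integral inequality is violated.
  by_contra! hlt
  have hclosed : IsClosed {x ∈ Icc a b | w x ≤ u x} := isClosed_Icc.isClosed_le hwc.continuousOn hu
  obtain ⟨x, ⟨⟨hax, hxb⟩, hwx⟩, hmin⟩ :=
    (isCompact_Icc.of_isClosed_subset hclosed (sep_subset _ _)).exists_isLeast
      ⟨b, ⟨hab, le_rfl⟩, hlt.le⟩
  have hint : ∫ y in a..x, u y ∂μ ≤ ∫ y in a..x, w y ∂μ := by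
    refine intervalIntegral.integral_mono_on_of_le_Ioo hax
      (ContinuousOn.intervalIntegrable_of_Icc hax (hu.mono (Icc_subset_Icc_right hxb)))
      (hwc.intervalIntegrable _ _) fun y hy => ?_
    by_contra! h
    exact hy.2.not_ge (hmin ⟨⟨hy.1.le, hy.2.le.trans hxb⟩, h.le⟩)
  have := hle x ⟨hax, hxb⟩
  have := hw_eq x hax
  have := mul_le_mul_of_nonneg_left hint hK
  linarith

theorem le_mul_exp_cumul_of_le_add_integral {u : ℝ → ℝ} {c K : ℝ} (hab : a ≤ b) (hK : 0 ≤ K)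
    (hu : ContinuousOn u (Icc a b))
    (hle : ∀ x ∈ Icc a b, u x ≤ c + K * ∫ y in a..x, u y ∂μ) :
    u b ≤ c * Real.exp (K * cumul μ a b) := by
  rw [← div_le_iff₀ (Real.exp_pos _)]
  refine le_of_forall_gt_imp_ge_of_dense fun c' hc => ?_
  rw [div_le_iff₀ (Real.exp_pos _)]
  exact le_mul_exp_cumul_of_lt_of_le_add_integral hab hK hu hle hc

theorem norm_le_integral_mul_exp_cumul {E : Type*} [NormedAddCommGroup E] [NormedSpace ℝ E]
    {d f : ℝ → E} {e : ℝ → ℝ} {K : ℝ} (hab : a ≤ b) (hK : 0 ≤ K)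
    (hf : IntervalIntegrable f μ a b) (hd : ∀ x ∈ Icc a b, d x = ∫ y in a..x, f y ∂μ)
    (he : IntervalIntegrable e μ a b) (he₀ : ∀ x, 0 ≤ e x)
    (hfe : ∀ᵐ x ∂μ.restrict (Ioc a b), ‖f x‖ ≤ K * ‖d x‖ + e x) :
    ‖d b‖ ≤ (∫ x in a..b, e x ∂μ) * Real.exp (K * cumul μ a b) := by
  have hdc : ContinuousOn d (Icc a b) := by
    have := intervalIntegral.continuousOn_primitive_interval' hf left_mem_uIcc
    rw [uIcc_of_le hab] at this
    exact this.congr hd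
  refine le_mul_exp_cumul_of_le_add_integral (u := fun x => ‖d x‖) hab hK hdc.norm
    fun x ⟨hax, hxb⟩ => ?_
  have hdi : IntervalIntegrable (fun y => K * ‖d y‖) μ a x :=
    (ContinuousOn.intervalIntegrable_of_Icc hax
      (hdc.norm.mono (Icc_subset_Icc_right hxb))).const_mul K
  have hei : IntervalIntegrable e μ a x :=
    he.mono_set (by rw [uIcc_of_le hab, uIcc_of_le hax]; exact Icc_subset_Icc_right hxb)
  calc ‖d x‖ = ‖∫ y in a..x, f y ∂μ‖ := by rw [hd x ⟨hax, hxb⟩]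
    _ ≤ ∫ y in a..x, (K * ‖d y‖ + e y) ∂μ :=
      intervalIntegral.norm_integral_le_of_norm_le hax
        ((ae_restrict_iff' measurableSet_Ioc).1
          (ae_restrict_of_ae_restrict_of_subset (Ioc_subset_Ioc_right hxb) hfe)) (hdi.add hei)
    _ = ∫ y in a..x, e y ∂μ + K * ∫ y in a..x, ‖d y‖ ∂μ := by
      rw [intervalIntegral.integral_add hdi hei, intervalIntegral.integral_const_mul, add_comm]
    _ ≤ ∫ y in a..b, e y ∂μ + K * ∫ y in a..x, ‖d y‖ ∂μ := by
      gcongr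
      exact intervalIntegral.integral_mono_interval le_rfl hax hxb (.of_forall he₀) he

end Cumul

section ConstantCoefficients

lemma exists_hasDerivAt_clm {E : Type*} [NormedAddCommGroup E] [NormedSpace ℝ E] [CompleteSpace E]
    (T : E →L[ℝ] E) (v : E) : ∃ V : ℝ → E, V 0 = v ∧ ∀ t, HasDerivAt V (T (V t)) t :=
  ⟨fun t => NormedSpace.exp (t • T) v, by simp, fun t =>
    (hasDerivAt_exp_smul_const' T t).clm_apply (hasDerivAt_const t v) |>.congr_deriv (by simp)⟩

lemma exists_hasDerivAt_vecMul {n : Type*} [Fintype n] (M : Matrix n n ℂ) (v : n → ℂ) :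
    ∃ V : ℝ → n → ℂ, V 0 = v ∧ ∀ t, HasDerivAt V (V t ᵥ* M) t :=
  exists_hasDerivAt_clm ((Matrix.vecMulLinear M).toContinuousLinearMap.restrictScalars ℝ) v

lemma norm_le_norm_mul_exp_of_hasDerivAt {E : Type*} [NormedAddCommGroup E] [NormedSpace ℝ E]
    {V V' : ℝ → E} {K : ℝ} (hV : ∀ t, HasDerivAt V (V' t) t) (hK : ∀ t, ‖V' t‖ ≤ K * ‖V t‖)
    {t : ℝ} (ht : 0 ≤ t) : ‖V t‖ ≤ ‖V 0‖ * Real.exp (K * t) := by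
  simpa only [gronwallBound_ε0, sub_zero] using
    norm_le_gronwallBound_of_norm_deriv_right_le (ε := 0) (b := t)
      (fun s _ => (hV s).continuousAt.continuousWithinAt) (fun s _ => (hV s).hasDerivWithinAt)
      le_rfl (fun s _ => (hK s).trans_eq (add_zero _).symm) t ⟨ht, le_rfl⟩

/-- The matrix `(i z A - B) j`, by which the transfer matrix is multiplied on the right in the
differential form `d𝔄 = 𝔄 (i z A - B) j dμ` of the canonical system. -/
def systemMatrix (z a : ℂ) : Matrix (Fin 2) (Fin 2) ℂ :=
  ((Complex.I * z) • coeffA a - coeffB a) * jMat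

/-- The part `i z A j` of `systemMatrix z a` that is linear in `z`. -/
def leadingMatrix (z a : ℂ) : Matrix (Fin 2) (Fin 2) ℂ := (Complex.I * z) • (coeffA a * jMat)

lemma vecMul_leadingMatrix (z a : ℂ) (v : Fin 2 → ℂ) :
    v ᵥ* leadingMatrix z a =
      ![Complex.I * z * (a * v 1 - v 0), Complex.I * z * (v 1 - star a * v 0)] := by
  ext i
  fin_cases i <;>
  · simp [leadingMatrix, coeffA, jMat, Matrix.vecMul, dotProduct]
    ring

lemma vecMul_systemMatrix (z a : ℂ) (v : Fin 2 → ℂ) :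
    v ᵥ* systemMatrix z a = v ᵥ* leadingMatrix z a - ![a * v 1, star a * v 0] := by
  rw [vecMul_leadingMatrix]
  ext i
  fin_cases i <;>
  · simp [systemMatrix, coeffA, coeffB, jMat, Matrix.vecMul, dotProduct]
    ring

lemma norm_vecMul_leadingMatrix_le {z a : ℂ} (ha : ‖a‖ ≤ 1) (v : Fin 2 → ℂ) :
    ‖v ᵥ* leadingMatrix z a‖ ≤ 2 * ‖z‖ * ‖v‖ := by
  have h₀ := norm_le_pi_norm v 0
  have h₁ := norm_le_pi_norm v 1
  rw [vecMul_leadingMatrix, pi_norm_le_iff_of_nonneg (by positivity), Fin.forall_fin_two]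
  constructor
  · calc ‖Complex.I * z * (a * v 1 - v 0)‖ = ‖z‖ * ‖a * v 1 - v 0‖ := by simp
      _ ≤ ‖z‖ * (‖a‖ * ‖v 1‖ + ‖v 0‖) := by
        gcongr
        exact (norm_sub_le _ _).trans_eq (by rw [norm_mul])
      _ ≤ ‖z‖ * (1 * ‖v‖ + ‖v‖) := by gcongr
      _ = 2 * ‖z‖ * ‖v‖ := by ring
  · calc ‖Complex.I * z * (v 1 - star a * v 0)‖ = ‖z‖ * ‖v 1 - star a * v 0‖ := by simp
      _ ≤ ‖z‖ * (‖v 1‖ + ‖a‖ * ‖v 0‖) := by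
        gcongr
        exact (norm_sub_le _ _).trans_eq (by rw [norm_mul, norm_star])
      _ ≤ ‖z‖ * (‖v‖ + 1 * ‖v‖) := by gcongr
      _ = 2 * ‖z‖ * ‖v‖ := by ring

lemma norm_vecMul_systemMatrix_sub_le {z a : ℂ} (ha : ‖a‖ ≤ 1) (v : Fin 2 → ℂ) :
    ‖v ᵥ* systemMatrix z a - v ᵥ* leadingMatrix z a‖ ≤ ‖v‖ := by
  rw [vecMul_systemMatrix, sub_sub_cancel_left, norm_neg,
    pi_norm_le_iff_of_nonneg (norm_nonneg v), Fin.forall_fin_two]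
  constructor
  · calc ‖a * v 1‖ = ‖a‖ * ‖v 1‖ := norm_mul _ _
      _ ≤ ‖v‖ := (mul_le_of_le_one_left (norm_nonneg _) ha).trans (norm_le_pi_norm v 1)
  · calc ‖star a * v 0‖ = ‖a‖ * ‖v 0‖ := by rw [norm_mul, norm_star]
      _ ≤ ‖v‖ := (mul_le_of_le_one_left (norm_nonneg _) ha).trans (norm_le_pi_norm v 0)

lemma norm_vecMul_leadingMatrix_sub_le (z a b : ℂ) (v : Fin 2 → ℂ) :
    ‖v ᵥ* leadingMatrix z a - v ᵥ* leadingMatrix z b‖ ≤ ‖z‖ * ‖a - b‖ * ‖v‖ := by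
  have hsub : v ᵥ* leadingMatrix z a - v ᵥ* leadingMatrix z b =
      ![Complex.I * z * (a - b) * v 1, -(Complex.I * z * star (a - b) * v 0)] := by
    ext i
    fin_cases i <;>
    · simp [vecMul_leadingMatrix]
      ring
  rw [hsub, pi_norm_le_iff_of_nonneg (by positivity), Fin.forall_fin_two]
  constructor
  · calc ‖Complex.I * z * (a - b) * v 1‖ = ‖z‖ * ‖a - b‖ * ‖v 1‖ := by simp
      _ ≤ ‖z‖ * ‖a - b‖ * ‖v‖ := by gcongr; exact norm_le_pi_norm v 1
  · calc ‖-(Complex.I * z * star (a - b) * v 0)‖ = ‖z‖ * ‖a - b‖ * ‖v 0‖ := by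
          rw [norm_neg, norm_mul, norm_mul, norm_star, norm_mul, Complex.norm_I, one_mul]
      _ ≤ ‖z‖ * ‖a - b‖ * ‖v‖ := by gcongr; exact norm_le_pi_norm v 0

lemma norm_vecMul_systemMatrix_sub_vecMul_leadingMatrix_le {z a b : ℂ} (ha : ‖a‖ ≤ 1)
    (u v : Fin 2 → ℂ) :
    ‖u ᵥ* systemMatrix z a - v ᵥ* leadingMatrix z b‖ ≤
      (2 * ‖z‖ + 1) * ‖u - v‖ + (‖z‖ * ‖a - b‖ + 1) * ‖v‖ := by
  have hsplit : u ᵥ* systemMatrix z a - v ᵥ* leadingMatrix z b =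
      ((u - v) ᵥ* systemMatrix z a - (u - v) ᵥ* leadingMatrix z a) + (u - v) ᵥ* leadingMatrix z a +
        ((v ᵥ* leadingMatrix z a - v ᵥ* leadingMatrix z b) +
          (v ᵥ* systemMatrix z a - v ᵥ* leadingMatrix z a)) := by
    simp only [Matrix.sub_vecMul]
    abel
  calc ‖u ᵥ* systemMatrix z a - v ᵥ* leadingMatrix z b‖
      ≤ (‖u - v‖ + 2 * ‖z‖ * ‖u - v‖) + (‖z‖ * ‖a - b‖ * ‖v‖ + ‖v‖) := by
        rw [hsplit]
        exact norm_add_le_of_le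
          (norm_add_le_of_le (norm_vecMul_systemMatrix_sub_le ha _)
            (norm_vecMul_leadingMatrix_le ha _))
          (norm_add_le_of_le (norm_vecMul_leadingMatrix_sub_le z a b v)
            (norm_vecMul_systemMatrix_sub_le ha v))
    _ = (2 * ‖z‖ + 1) * ‖u - v‖ + (‖z‖ * ‖a - b‖ + 1) * ‖v‖ := by ring

/-- The indefinite form `v j v*` of a row vector `v`; a point `w` lies in the Weyl disk of `T` if
and only if this form is nonnegative at `(w 1) T`. -/
noncomputable def weylForm (v : Fin 2 → ℂ) : ℝ := ‖v 1‖ ^ 2 - ‖v 0‖ ^ 2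

lemma weylForm_eq (v : Fin 2 → ℂ) : weylForm v = ((v ᵥ* jMat) ⬝ᵥ star v).re := by
  simp [weylForm, jMat, Matrix.vecMul, dotProduct, Complex.sq_norm, Complex.normSq_apply]
  ring

variable {z a σ : ℂ} {V : ℝ → Fin 2 → ℂ}

lemma hasDerivAt_weylForm {t : ℝ} (hV : HasDerivAt V (V t ᵥ* leadingMatrix z a) t) :
    HasDerivAt (fun t => weylForm (V t))
      (-(2 * z.im) * ((V t ᵥ* coeffA a) ⬝ᵥ star (V t)).re) t := by
  rw [vecMul_leadingMatrix] at hV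
  have hV' := hasDerivAt_pi.1 hV
  refine ((hV' 1).norm_sq.sub (hV' 0).norm_sq).congr_deriv ?_
  simp [coeffA, Matrix.vecMul, dotProduct, Complex.inner]
  ring

lemma one_add_norm_sq_mul_re_coeffA (hσ : (1 + (‖σ‖ : ℂ) ^ 2) * a = 2 * σ) (v : Fin 2 → ℂ) :
    (1 + ‖σ‖ ^ 2) * ((v ᵥ* coeffA a) ⬝ᵥ star v).re =
      ‖v 0 - σ * v 1‖ ^ 2 + ‖v 1 - star σ * v 0‖ ^ 2 := by
  have hσ' : ((1 + ‖σ‖ ^ 2 : ℝ) : ℂ) * a = (2 : ℝ) * σ := mod_cast hσ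
  have hre := congrArg Complex.re hσ'
  have him := congrArg Complex.im hσ'
  rw [Complex.re_ofReal_mul, Complex.re_ofReal_mul, Complex.sq_norm, Complex.normSq_apply] at hre
  rw [Complex.im_ofReal_mul, Complex.im_ofReal_mul, Complex.sq_norm, Complex.normSq_apply] at him
  simp [coeffA, Matrix.vecMul, dotProduct, Complex.sq_norm, Complex.normSq_apply]
  linear_combination
    (-2 * ((v 0).re * (v 1).re + (v 0).im * (v 1).im)) * hre +
      (-2 * ((v 0).im * (v 1).re - (v 0).re * (v 1).im)) * him

lemma norm_sq_le_two_mul_re_coeffA (hσ₁ : ‖σ‖ ≤ 1) (hσ : (1 + (‖σ‖ : ℂ) ^ 2) * a = 2 * σ)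
    (v : Fin 2 → ℂ) :
    ‖v 0 - σ * v 1‖ ^ 2 ≤ 2 * ((v ᵥ* coeffA a) ⬝ᵥ star v).re := by
  have h := one_add_norm_sq_mul_re_coeffA hσ v
  have hσ₂ : ‖σ‖ ^ 2 ≤ 1 := pow_le_one₀ (norm_nonneg σ) hσ₁
  nlinarith [sq_nonneg ‖v 0 - σ * v 1‖, sq_nonneg ‖v 1 - star σ * v 0‖, sq_nonneg ‖σ‖]

lemma hasDerivAt_sub_mul (hσ : (1 + (‖σ‖ : ℂ) ^ 2) * a = 2 * σ) {t : ℝ}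
    (hV : HasDerivAt V (V t ᵥ* leadingMatrix z a) t) :
    HasDerivAt (fun t => V t 0 - σ * V t 1)
      (-(Complex.I * z * ((1 - ‖σ‖ ^ 2) / (1 + ‖σ‖ ^ 2) : ℝ) * (V t 0 - σ * V t 1))) t := by
  have hne : (1 + (‖σ‖ : ℂ) ^ 2) ≠ 0 := by
    exact_mod_cast (by positivity : (1 + ‖σ‖ ^ 2) ≠ 0)
  have ha : a = 2 * σ / (1 + (‖σ‖ : ℂ) ^ 2) := by rw [eq_div_iff hne, ← hσ, mul_comm]
  have hstar : star a = 2 * star σ / (1 + (‖σ‖ : ℂ) ^ 2) := by simp [ha]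
  have hσσ : σ * star σ = (‖σ‖ : ℂ) ^ 2 := Complex.mul_conj' σ
  rw [vecMul_leadingMatrix, hstar, ha] at hV
  have hV' := hasDerivAt_pi.1 hV
  refine ((hV' 0).sub ((hV' 1).const_mul σ)).congr_deriv ?_
  simp only [Matrix.cons_val_zero, Matrix.cons_val_one]
  push_cast
  field_simp
  linear_combination (2 * z * V t 0) * hσσ

lemma norm_sub_mul_sq_le_of_hasDerivAt (hz : 0 ≤ z.im) (hσ₁ : ‖σ‖ ≤ 1)
    (hσ : (1 + (‖σ‖ : ℂ) ^ 2) * a = 2 * σ)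
    (hV : ∀ t, HasDerivAt V (V t ᵥ* leadingMatrix z a) t) {t : ℝ} (ht : 0 ≤ t) :
    ‖V 0 0 - σ * V 0 1‖ ^ 2 ≤ ‖V t 0 - σ * V t 1‖ ^ 2 := by
  have hderiv (t : ℝ) := (hasDerivAt_sub_mul hσ (hV t)).norm_sq
  refine monotone_of_hasDerivAt_nonneg hderiv (fun t => ?_) ht
  have hκ : 0 ≤ (1 - ‖σ‖ ^ 2) / (1 + ‖σ‖ ^ 2) :=
    div_nonneg (sub_nonneg.2 (pow_le_one₀ (norm_nonneg σ) hσ₁)) (by positivity)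
  simp only [Pi.zero_apply]
  generalize (1 - ‖σ‖ ^ 2) / (1 + ‖σ‖ ^ 2) = κ at hκ
  generalize V t 0 - σ * V t 1 = f
  have hinner : inner ℝ f (-(Complex.I * z * κ * f)) = z.im * κ * ‖f‖ ^ 2 := by
    simp [Complex.inner, Complex.sq_norm, Complex.normSq_apply]
    ring
  rw [hinner]
  positivity

theorem weylForm_add_im_mul_norm_sq_le (hz : 0 ≤ z.im) (hσ₁ : ‖σ‖ ≤ 1)
    (hσ : (1 + (‖σ‖ : ℂ) ^ 2) * a = 2 * σ)
    (hV : ∀ t, HasDerivAt V (V t ᵥ* leadingMatrix z a) t) {t : ℝ} (ht : 0 ≤ t) :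
    weylForm (V t) + z.im * t * ‖V 0 0 - σ * V 0 1‖ ^ 2 ≤ weylForm (V 0) := by
  have hderiv (t : ℝ) := hasDerivAt_weylForm (hV t)
  have hdecay := (convex_Ici (0 : ℝ)).image_sub_le_mul_sub_of_deriv_le
    (f := fun t => weylForm (V t)) (C := -(z.im * ‖V 0 0 - σ * V 0 1‖ ^ 2))
    (fun s _ => (hderiv s).continuousAt.continuousWithinAt)
    (fun s _ => (hderiv s).differentiableAt.differentiableWithinAt)
    (fun s hs => by
      have hs₀ : 0 ≤ s := interior_subset hs
      have hle := mul_le_mul_of_nonneg_left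
        ((norm_sub_mul_sq_le_of_hasDerivAt hz hσ₁ hσ hV hs₀).trans
          (norm_sq_le_two_mul_re_coeffA hσ₁ hσ (V s))) hz
      rw [(hderiv s).deriv]
      linarith)
    0 self_mem_Ici t ht ht
  linarith

end ConstantCoefficients

section TransferMatrix

lemma mem_weylDisk_iff {T : Matrix (Fin 2) (Fin 2) ℂ} {w : ℂ} :
    w ∈ weylDisk T ↔ 0 ≤ weylForm (![w, 1] ᵥ* T) := by
  rw [weylForm_eq, Matrix.star_vecMul, Matrix.dotProduct_mulVec, Matrix.vecMul_vecMul,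
    Matrix.vecMul_vecMul, ← Matrix.mul_assoc, weylDisk, mem_ofPred_eq]

lemma jMat_mul_jMat : jMat * jMat = 1 := by
  ext i j
  fin_cases i <;> fin_cases j <;> simp [jMat]

lemma vecMul_mul_jMat_apply (v : Fin 2 → ℂ) (M : Matrix (Fin 2) (Fin 2) ℂ) (i : Fin 2) :
    (v ᵥ* (M * jMat)) i = ∑ p, v p * jMat i i * M p i := by
  fin_cases i <;> simp [jMat, Matrix.vecMul, dotProduct, Matrix.mul_apply]

lemma vecMul_vecMul_systemMatrix_apply (v : Fin 2 → ℂ) (M : Matrix (Fin 2) (Fin 2) ℂ) (z a : ℂ)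
    (i : Fin 2) :
    (v ᵥ* M ᵥ* systemMatrix z a) i =
      ∑ p, v p * jMat i i * (M * ((Complex.I * z) • coeffA a - coeffB a)) p i := by
  rw [systemMatrix, Matrix.vecMul_vecMul, ← Matrix.mul_assoc, vecMul_mul_jMat_apply]

variable {μ : Measure ℝ} {a : ℝ → ℂ} {𝔄 : ℂ → ℝ → Matrix (Fin 2) (Fin 2) ℂ}

lemma IsTransferMatrix.intervalIntegrable_vecMul (h : IsTransferMatrix μ a 𝔄) (z : ℂ)
    (v : Fin 2 → ℂ) {ℓ : ℝ} (hℓ : 0 ≤ ℓ) :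
    IntervalIntegrable (fun l => v ᵥ* 𝔄 z l ᵥ* systemMatrix z (a l)) μ 0 ℓ := by
  have heval (i : Fin 2) :
      IntervalIntegrable (fun l => (v ᵥ* 𝔄 z l ᵥ* systemMatrix z (a l)) i) μ 0 ℓ := by
    simp only [vecMul_vecMul_systemMatrix_apply]
    simpa only [Finset.sum_fn] using IntervalIntegrable.sum Finset.univ
      fun p _ => (h z ℓ hℓ p i).1.const_mul (v p * jMat i i)
  exact ⟨.of_eval fun i => (heval i).1, .of_eval fun i => (heval i).2⟩

lemma IsTransferMatrix.vecMul_eq_add_integral (h : IsTransferMatrix μ a 𝔄) (z : ℂ)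
    (v : Fin 2 → ℂ) {ℓ : ℝ} (hℓ : 0 ≤ ℓ) :
    v ᵥ* 𝔄 z ℓ = v + ∫ l in (0 : ℝ)..ℓ, v ᵥ* 𝔄 z l ᵥ* systemMatrix z (a l) ∂μ := by
  ext i
  have hint := (h.intervalIntegrable_vecMul z v hℓ).1
  have hsum : (∫ l in (0 : ℝ)..ℓ, v ᵥ* 𝔄 z l ᵥ* systemMatrix z (a l) ∂μ) i =
      ∑ p, v p * jMat i i * (𝔄 z ℓ * jMat - jMat) p i := by
    rw [intervalIntegral.integral_of_le hℓ, eval_integral hint.eval,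
      ← intervalIntegral.integral_of_le hℓ]
    simp only [vecMul_vecMul_systemMatrix_apply]
    rw [intervalIntegral.integral_finsetSum fun p _ => (h z ℓ hℓ p i).1.const_mul _]
    simp only [intervalIntegral.integral_const_mul, Matrix.sub_apply, (h z ℓ hℓ _ i).2,
      add_sub_cancel_left]
  rw [Pi.add_apply, hsum, ← vecMul_mul_jMat_apply, Matrix.sub_mul, Matrix.mul_assoc, jMat_mul_jMat,
    Matrix.mul_one, Matrix.vecMul_sub, Matrix.vecMul_one, Pi.sub_apply, add_sub_cancel]

variable [NullSingletonClass μ]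

lemma IsTransferMatrix.continuousOn_vecMul (h : IsTransferMatrix μ a 𝔄) (z : ℂ)
    (v : Fin 2 → ℂ) {L : ℝ} (hL : 0 ≤ L) : ContinuousOn (fun ℓ => v ᵥ* 𝔄 z ℓ) (Icc 0 L) := by
  have hprim := intervalIntegral.continuousOn_primitive_interval'
    (h.intervalIntegrable_vecMul z v hL) left_mem_uIcc
  rw [uIcc_of_le hL] at hprim
  exact (hprim.const_add v).congr fun ℓ hℓ => h.vecMul_eq_add_integral z v hℓ.1

lemma IsTransferMatrix.norm_le_one_of_mem_weylDisk (h : IsTransferMatrix μ a 𝔄) {z w : ℂ}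
    (hw : ∀ ℓ > 0, w ∈ weylDisk (𝔄 z ℓ)) : ‖w‖ ≤ 1 := by
  have hcont : ContinuousOn (fun ℓ => weylForm (![w, 1] ᵥ* 𝔄 z ℓ)) (Icc 0 1) := by
    have hv := continuousOn_pi.1 (h.continuousOn_vecMul z ![w, 1] zero_le_one)
    exact ((hv 1).norm.pow 2).sub ((hv 0).norm.pow 2)
  have hzero : (0 : ℝ) ∈ closure (Ioc 0 1) := by simp [closure_Ioc]
  have hform : 0 ≤ weylForm (![w, 1] ᵥ* 𝔄 z 0) :=
    ContinuousWithinAt.closure_le hzero continuousWithinAt_const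
      ((hcont 0 (by simp)).mono Ioc_subset_Icc_self) fun ℓ hℓ => mem_weylDisk_iff.1 (hw ℓ hℓ.1)
  rw [h.vecMul_eq_add_integral z _ le_rfl, intervalIntegral.integral_same, add_zero] at hform
  simpa [weylForm] using hform

end TransferMatrix

section Comparison

variable {μ : Measure ℝ} {a : ℝ → ℂ}

lemma IsParameters.nullSingletonClass (h : IsParameters μ a) : NullSingletonClass μ :=
  ⟨h.no_atoms⟩

lemma IsParameters.isLocallyFiniteMeasure (h : IsParameters μ a) : IsLocallyFiniteMeasure μ :=
  have : IsFiniteMeasureOnCompacts μ := ⟨fun K hK => h.finite_on_compacts K hK⟩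
  inferInstance

lemma IsParameters.ae_norm_le_one (h : IsParameters μ a) (ℓ : ℝ) :
    ∀ᵐ l ∂μ.restrict (Ioc 0 ℓ), ‖a l‖ ≤ 1 :=
  ae_restrict_of_ae_restrict_of_subset (fun _ hl => hl.1.le) h.norm_le_one

lemma IsParameters.intervalIntegrable (h : IsParameters μ a) {ℓ : ℝ} (hℓ : 0 ≤ ℓ) :
    IntervalIntegrable a μ 0 ℓ := by
  have := h.isLocallyFiniteMeasure
  have : IsFiniteMeasure (μ.restrict (Ioc 0 ℓ)) := ⟨by simp [measure_Ioc_lt_top]⟩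
  rw [intervalIntegrable_iff_integrableOn_Ioc_of_le hℓ]
  exact Integrable.of_bound (h.measurable.mono_set fun _ hl => hl.1.le) 1 (h.ae_norm_le_one ℓ)

lemma IsParameters.norm_le_one_of_tendsto_average (h : IsParameters μ a) {a₀ : ℂ}
    (hpos : ∀ ℓ > 0, 0 < cumul μ 0 ℓ)
    (hLeb : Tendsto (fun ℓ => (cumul μ 0 ℓ)⁻¹ * ∫ l in (0 : ℝ)..ℓ, ‖a l - a₀‖ ∂μ)
      (𝓝[>] 0) (𝓝 0)) : ‖a₀‖ ≤ 1 := by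
  have := h.isLocallyFiniteMeasure
  rw [← sub_nonpos]
  refine ge_of_tendsto hLeb ?_
  filter_upwards [self_mem_nhdsWithin] with ℓ (hℓ : 0 < ℓ)
  rw [inv_mul_eq_div, le_div_iff₀ (hpos ℓ hℓ), cumul_eq_integral hℓ.le,
    ← intervalIntegral.integral_const_mul]
  refine intervalIntegral.integral_mono_ae_restrict hℓ.le intervalIntegrable_const
    ((h.intervalIntegrable hℓ.le).sub intervalIntegrable_const).norm ?_
  have hle : ∀ᵐ l ∂μ.restrict (Icc 0 ℓ), ‖a l‖ ≤ 1 :=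
    ae_restrict_of_ae_restrict_of_subset (fun _ hl => hl.1) h.norm_le_one
  filter_upwards [hle] with l hl
  have := norm_sub_norm_le a₀ (a l)
  rw [norm_sub_rev] at this
  linarith

variable {𝔄 : ℂ → ℝ → Matrix (Fin 2) (Fin 2) ℂ} {a₀ z : ℂ}

theorem IsTransferMatrix.norm_vecMul_sub_le (h : IsTransferMatrix μ a 𝔄) (hμ : IsParameters μ a)
    {V : ℝ → Fin 2 → ℂ} (hV : ∀ t, HasDerivAt V (V t ᵥ* leadingMatrix z a₀) t) {L M : ℝ}
    (hL : 0 ≤ L) (hM : ∀ t ∈ Icc 0 (cumul μ 0 L), ‖V t‖ ≤ M) :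
    ‖V 0 ᵥ* 𝔄 z L - V (cumul μ 0 L)‖ ≤
      M * (‖z‖ * (∫ l in (0 : ℝ)..L, ‖a l - a₀‖ ∂μ) + cumul μ 0 L) *
        Real.exp ((2 * ‖z‖ + 1) * cumul μ 0 L) := by
  have := hμ.nullSingletonClass
  have := hμ.isLocallyFiniteMeasure
  have hM₀ : 0 ≤ M := (norm_nonneg _).trans (hM 0 ⟨le_rfl, cumul_nonneg L⟩)
  have hVc : Continuous V := continuous_iff_continuousAt.2 fun t => (hV t).continuousAt
  have hVc' : Continuous fun t => V t ᵥ* leadingMatrix z a₀ := by fun_prop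
  have hVi (x : ℝ) : IntervalIntegrable (fun l => V (cumul μ 0 l) ᵥ* leadingMatrix z a₀) μ 0 x :=
    (hVc'.comp continuous_cumul).intervalIntegrable 0 x
  have ha : IntervalIntegrable (fun l => ‖a l - a₀‖) μ 0 L :=
    ((hμ.intervalIntegrable hL).sub intervalIntegrable_const).norm
  have hdiff (x : ℝ) (hx : x ∈ Icc 0 L) : V 0 ᵥ* 𝔄 z x - V (cumul μ 0 x) =
      ∫ l in (0 : ℝ)..x, (V 0 ᵥ* 𝔄 z l ᵥ* systemMatrix z (a l) -
        V (cumul μ 0 l) ᵥ* leadingMatrix z a₀) ∂μ := by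
    rw [intervalIntegral.integral_sub (h.intervalIntegrable_vecMul z _ hx.1) (hVi x),
      integral_comp_cumul hV hVc' hx.1, h.vecMul_eq_add_integral z _ hx.1]
    abel
  have hbound := norm_le_integral_mul_exp_cumul (K := 2 * ‖z‖ + 1)
    (e := fun l => M * (‖z‖ * ‖a l - a₀‖ + 1)) hL (by positivity)
    ((h.intervalIntegrable_vecMul z _ hL).sub (hVi L)) hdiff
    (((ha.const_mul _).add intervalIntegrable_const).const_mul M) (fun l => by positivity) <| by
      filter_upwards [hμ.ae_norm_le_one L, ae_restrict_mem measurableSet_Ioc] with l hal hl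
      refine (norm_vecMul_systemMatrix_sub_vecMul_leadingMatrix_le hal _ _).trans ?_
      rw [mul_comm M]
      gcongr
      exact hM _ ⟨cumul_nonneg l, monotone_cumul hl.2⟩
  rwa [intervalIntegral.integral_const_mul,
    intervalIntegral.integral_add (ha.const_mul _) intervalIntegrable_const,
    intervalIntegral.integral_const_mul, ← cumul_eq_integral hL] at hbound

lemma neg_mul_le_weylForm {u v : Fin 2 → ℂ} {e M : ℝ} (hu : 0 ≤ weylForm u) (huv : ‖u - v‖ ≤ e)
    (hv : ‖v‖ ≤ M) : -(4 * M * e) ≤ weylForm v := by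
  have hu' : ‖u 0‖ ≤ ‖u 1‖ := le_of_sq_le_sq (sub_nonneg.1 hu) (norm_nonneg _)
  have h₀ : ‖v 0‖ - ‖u 0‖ ≤ e := by
    rw [norm_sub_rev] at huv
    exact (norm_sub_norm_le _ _).trans ((norm_le_pi_norm (v - u) 0).trans huv)
  have h₁ : ‖u 1‖ - ‖v 1‖ ≤ e :=
    (norm_sub_norm_le _ _).trans ((norm_le_pi_norm (u - v) 1).trans huv)
  have he : 0 ≤ e := (norm_nonneg _).trans huv
  calc -(4 * M * e) = -(2 * e) * (M + M) := by ring
    _ ≤ -(2 * e) * (‖v 1‖ + ‖v 0‖) :=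
      mul_le_mul_of_nonpos_left (add_le_add ((norm_le_pi_norm v 1).trans hv)
        ((norm_le_pi_norm v 0).trans hv)) (by linarith)
    _ ≤ (‖v 1‖ - ‖v 0‖) * (‖v 1‖ + ‖v 0‖) := by
      gcongr
      linarith
    _ = weylForm v := by rw [weylForm]; ring

theorem im_mul_cumul_mul_norm_sub_sq_le (h : IsTransferMatrix μ a 𝔄) (hμ : IsParameters μ a)
    (hz : 0 ≤ z.im) {w σ : ℂ} (hw : ∀ ℓ > 0, w ∈ weylDisk (𝔄 z ℓ)) (ha₀ : ‖a₀‖ ≤ 1)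
    (hσ₁ : ‖σ‖ ≤ 1) (hσ : (1 + (‖σ‖ : ℂ) ^ 2) * a₀ = 2 * σ) {L : ℝ} (hL : 0 < L) :
    z.im * cumul μ 0 L * ‖w - σ‖ ^ 2 ≤
      1 + 4 * Real.exp (2 * ‖z‖ * cumul μ 0 L) ^ 2 *
        (‖z‖ * (∫ l in (0 : ℝ)..L, ‖a l - a₀‖ ∂μ) + cumul μ 0 L) *
          Real.exp ((2 * ‖z‖ + 1) * cumul μ 0 L) := by
  have := hμ.nullSingletonClass
  have hw₁ := h.norm_le_one_of_mem_weylDisk hw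
  obtain ⟨V, hV₀, hV⟩ := exists_hasDerivAt_vecMul (leadingMatrix z a₀) ![w, 1]
  have hm : 0 ≤ cumul μ 0 L := cumul_nonneg L
  have hM (t : ℝ) (ht : t ∈ Icc 0 (cumul μ 0 L)) :
      ‖V t‖ ≤ Real.exp (2 * ‖z‖ * cumul μ 0 L) := by
    have hV₀' : ‖V 0‖ ≤ 1 := by
      simp [hV₀, pi_norm_le_iff_of_nonneg, Fin.forall_fin_two, hw₁]
    calc ‖V t‖ ≤ ‖V 0‖ * Real.exp (2 * ‖z‖ * t) :=
          norm_le_norm_mul_exp_of_hasDerivAt hV (fun t => norm_vecMul_leadingMatrix_le ha₀ _) ht.1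
      _ ≤ 1 * Real.exp (2 * ‖z‖ * cumul μ 0 L) := by
          gcongr
          exact ht.2
      _ = _ := one_mul _
  have hdist := h.norm_vecMul_sub_le hμ hV hL.le hM
  have hlower := neg_mul_le_weylForm (mem_weylDisk_iff.1 (hw L hL)) (hV₀ ▸ hdist)
    (hM _ ⟨hm, le_rfl⟩)
  have hdecay := weylForm_add_im_mul_norm_sq_le hz hσ₁ hσ hV hm
  have hinit : weylForm (V 0) ≤ 1 := by simp [hV₀, weylForm]
  have hσV : V 0 0 - σ * V 0 1 = w - σ := by simp [hV₀]
  rw [hσV] at hdecay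
  linarith

end Comparison

section Limit

/-- The boundary value `σ = a / (1 + √(1 - |a|²))` of the Schur function at infinity. For `|a| ≤ 1`
it is the solution of `2 σ = (1 + |σ|²) a` in the closed unit disk. -/
noncomputable def schurLimit (a : ℂ) : ℂ := a / (1 + (Real.sqrt (1 - ‖a‖ ^ 2) : ℂ))

lemma norm_schurLimit (a : ℂ) : ‖schurLimit a‖ = ‖a‖ / (1 + √(1 - ‖a‖ ^ 2)) := by
  have hpos : 0 ≤ 1 + √(1 - ‖a‖ ^ 2) := by positivity
  rw [schurLimit, norm_div]
  norm_cast
  rw [Real.norm_of_nonneg hpos]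

lemma norm_schurLimit_le_one {a : ℂ} (ha : ‖a‖ ≤ 1) : ‖schurLimit a‖ ≤ 1 := by
  rw [norm_schurLimit, div_le_one (by positivity)]
  exact ha.trans (le_add_of_nonneg_right (Real.sqrt_nonneg _))

lemma one_add_norm_schurLimit_sq_mul {a : ℂ} (ha : ‖a‖ ≤ 1) :
    (1 + (‖schurLimit a‖ : ℂ) ^ 2) * a = 2 * schurLimit a := by
  have hsq : √(1 - ‖a‖ ^ 2) ^ 2 = 1 - ‖a‖ ^ 2 :=
    Real.sq_sqrt (sub_nonneg.2 (pow_le_one₀ (norm_nonneg a) ha))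
  have hnorm : 1 + ‖schurLimit a‖ ^ 2 = 2 / (1 + √(1 - ‖a‖ ^ 2)) := by
    rw [norm_schurLimit]
    field_simp
    linear_combination hsq
  have hnorm' : 1 + (‖schurLimit a‖ : ℂ) ^ 2 = 2 / (1 + (√(1 - ‖a‖ ^ 2) : ℂ)) := mod_cast hnorm
  rw [hnorm', schurLimit, div_mul_eq_mul_div, mul_div_assoc]

lemma sin_mul_norm_le_im {z : ℂ} {δ : ℝ} (hδ : 0 < δ) (hz : z.arg ∈ Icc δ (Real.pi - δ)) :
    Real.sin δ * ‖z‖ ≤ z.im := by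
  rw [← Complex.norm_mul_sin_arg, mul_comm]
  gcongr
  have hδ' : -(Real.pi / 2) ≤ δ := by linarith [Real.pi_pos]
  rcases le_total z.arg (Real.pi / 2) with h | h
  · exact Real.sin_le_sin_of_le_of_le_pi_div_two hδ' h hz.1
  · rw [← Real.sin_pi_sub z.arg]
    exact Real.sin_le_sin_of_le_of_le_pi_div_two hδ' (by linarith) (by linarith [hz.2])

lemma exists_tendsto_cumul_eq {μ : Measure ℝ} [IsLocallyFiniteMeasure μ] [NullSingletonClass μ]
    {a : ℝ} (hpos : ∀ x > a, 0 < cumul μ a x) :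
    ∃ L : ℝ → ℝ, Tendsto L (𝓝[>] 0) (𝓝[>] a) ∧ ∀ᶠ t in 𝓝[>] 0, cumul μ a (L t) = t := by
  have hex : ∀ t ∈ Ioo 0 (cumul μ a (a + 1)), ∃ x, cumul μ a x = t := fun t ht => by
    obtain ⟨x, -, hx⟩ := intermediate_value_Icc (lt_add_one a).le
      (continuous_cumul (μ := μ) (a := a)).continuousOn
      (by rw [cumul_self]; exact Ioo_subset_Icc_self ht)
    exact ⟨x, hx⟩
  choose! L hL using hex
  have hLt : ∀ᶠ t in 𝓝[>] 0, cumul μ a (L t) = t := by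
    filter_upwards [Ioo_mem_nhdsGT (hpos _ (lt_add_one a))] with t ht using hL t ht
  refine ⟨L, (nhdsGT_basis a).tendsto_right_iff.2 fun x hx => ?_, hLt⟩
  filter_upwards [hLt, Ioo_mem_nhdsGT (hpos x hx)] with t ht ⟨ht₀, htx⟩
  rw [← ht] at ht₀ htx
  exact ⟨monotone_cumul.reflect_lt (by rwa [cumul_self]), monotone_cumul.reflect_lt htx⟩

variable {μ : Measure ℝ} {a : ℝ → ℂ} {𝔄 : ℂ → ℝ → Matrix (Fin 2) (Fin 2) ℂ} {s : ℂ → ℂ} {a₀ : ℂ}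

lemma tendsto_one_add_mul_exp (C : ℝ) {g : ℝ → ℝ} (hg : Tendsto g (𝓝[>] 0) (𝓝 0)) :
    Tendsto (fun t => 1 + 4 * Real.exp (2 * C) ^ 2 * (C * g t + t) * Real.exp (2 * C + t))
      (𝓝[>] 0) (𝓝 1) := by
  have ht : Tendsto (fun t : ℝ => t) (𝓝[>] 0) (𝓝 0) := nhdsWithin_le_nhds
  have hexp := (Real.continuous_exp.tendsto _).comp (ht.const_add (2 * C))
  simpa using ((((hg.const_mul C).add ht).const_mul
    (4 * Real.exp (2 * C) ^ 2)).mul hexp).const_add 1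

theorem eventually_mul_norm_sub_schurLimit_sq_le (hμ : IsParameters μ a)
    (hpos : ∀ ℓ > 0, 0 < cumul μ 0 ℓ) (h : IsTransferMatrix μ a 𝔄)
    (hs : ∀ z : ℂ, 0 < z.im → ∀ ℓ > 0, s z ∈ weylDisk (𝔄 z ℓ)) (ha₀ : ‖a₀‖ ≤ 1)
    (hLeb : Tendsto (fun ℓ => (cumul μ 0 ℓ)⁻¹ * ∫ l in (0 : ℝ)..ℓ, ‖a l - a₀‖ ∂μ)
      (𝓝[>] 0) (𝓝 0)) {C c : ℝ} (hC : 0 < C) (hc : 0 < c) :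
    ∀ᶠ z in Bornology.cobounded ℂ ⊓ 𝓟 {z : ℂ | c * ‖z‖ ≤ z.im},
      C * c * ‖s z - schurLimit a₀‖ ^ 2 ≤ 2 := by
  have := hμ.nullSingletonClass
  have := hμ.isLocallyFiniteMeasure
  obtain ⟨L, hL, hLt⟩ := exists_tendsto_cumul_eq hpos
  set avg : ℝ → ℝ := fun ℓ => (cumul μ 0 ℓ)⁻¹ * ∫ l in (0 : ℝ)..ℓ, ‖a l - a₀‖ ∂μ with havg
  have hbound := tendsto_one_add_mul_exp C (hLeb.comp hL)
  have hscale : Tendsto (fun z : ℂ => C / ‖z‖) (Bornology.cobounded ℂ) (𝓝[>] 0) :=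
    tendsto_nhdsWithin_iff.2 ⟨tendsto_norm_cobounded_atTop.const_div_atTop C,
      (tendsto_norm_cobounded_atTop.eventually_gt_atTop 0).mono fun z hz => div_pos hC hz⟩
  rw [eventually_inf_principal]
  filter_upwards [hscale.eventually (hbound.eventually_le_const one_lt_two),
    hscale.eventually hLt, hscale.eventually (hL self_mem_nhdsWithin),
    tendsto_norm_cobounded_atTop.eventually_gt_atTop 0] with z hle hcumul hLpos hz him
  have him₀ : 0 < z.im := (mul_pos hc hz).trans_le him
  have hzt : ‖z‖ * (C / ‖z‖) = C := mul_div_cancel₀ C hz.ne'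
  have hquant := im_mul_cumul_mul_norm_sub_sq_le h hμ him₀.le (hs z him₀) ha₀
    (norm_schurLimit_le_one ha₀) (one_add_norm_schurLimit_sq_mul ha₀) hLpos
  have hint : ‖z‖ * (∫ l in (0 : ℝ)..L (C / ‖z‖), ‖a l - a₀‖ ∂μ) = C * avg (L (C / ‖z‖)) := by
    simp only [havg, hcumul]
    field_simp
  rw [hint, hcumul, add_mul, mul_assoc 2, hzt, one_mul] at hquant
  calc C * c * ‖s z - schurLimit a₀‖ ^ 2
      = c * ‖z‖ * (C / ‖z‖) * ‖s z - schurLimit a₀‖ ^ 2 := by rw [mul_assoc c, hzt, mul_comm C]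
    _ ≤ z.im * (C / ‖z‖) * ‖s z - schurLimit a₀‖ ^ 2 := by gcongr
    _ ≤ 2 := hquant.trans hle

theorem tendsto_schurLimit (hμ : IsParameters μ a)
    (hpos : ∀ ℓ > 0, 0 < cumul μ 0 ℓ) (h : IsTransferMatrix μ a 𝔄)
    (hs : ∀ z : ℂ, 0 < z.im → ∀ ℓ > 0, s z ∈ weylDisk (𝔄 z ℓ))
    (hLeb : Tendsto (fun ℓ => (cumul μ 0 ℓ)⁻¹ * ∫ l in (0 : ℝ)..ℓ, ‖a l - a₀‖ ∂μ)
      (𝓝[>] 0) (𝓝 0)) {c : ℝ} (hc : 0 < c) :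
    Tendsto s (Bornology.cobounded ℂ ⊓ 𝓟 {z : ℂ | c * ‖z‖ ≤ z.im}) (𝓝 (schurLimit a₀)) := by
  have ha₀ := hμ.norm_le_one_of_tendsto_average hpos hLeb
  refine Metric.tendsto_nhds.2 fun ε hε => ?_
  filter_upwards [eventually_mul_norm_sub_schurLimit_sq_le hμ hpos h hs ha₀ hLeb
    (show 0 < 3 / (c * ε ^ 2) by positivity) hc] with z hz
  rw [dist_eq_norm]
  by_contra! hle
  have hthree : 3 ≤ 3 / (c * ε ^ 2) * c * ‖s z - schurLimit a₀‖ ^ 2 := by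
    calc 3 = 3 / (c * ε ^ 2) * c * ε ^ 2 := by field_simp
      _ ≤ _ := by gcongr
  linarith

end Limit

end ArovGauge

theorem theorem4p1_general (μ : Measure ℝ) (a : ℝ → ℂ)
    (hparam : ArovGauge.IsParameters μ a)
    (hpos : ∀ ℓ : ℝ, 0 < ℓ → 0 < μ (Ico 0 ℓ))
    (𝔄 : ℂ → ℝ → Matrix (Fin 2) (Fin 2) ℂ)
    (h𝔄 : ArovGauge.IsTransferMatrix μ a 𝔄)
    (s : ℂ → ℂ) (hs : ∀ z : ℂ, 0 < z.im → ∀ ℓ > 0, s z ∈ ArovGauge.weylDisk (𝔄 z ℓ))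
    (a₀ : ℂ)
    (hLeb : Tendsto (fun ℓ : ℝ => (μ.real (Ico 0 ℓ))⁻¹ * ∫ l in (0 : ℝ)..ℓ, ‖a l - a₀‖ ∂μ)
      (𝓝[>] 0) (𝓝 0))
    (δ : ℝ) (hδ : 0 < δ) :
    Tendsto s (Bornology.cobounded ℂ ⊓ 𝓟 {z : ℂ | z.arg ∈ Icc δ (Real.pi - δ)})
      (𝓝 (a₀ / (1 + (Real.sqrt (1 - ‖a₀‖ ^ 2) : ℂ)))) := by
  have := hparam.nullSingletonClass
  have := hparam.isLocallyFiniteMeasure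
  have hcumul (ℓ : ℝ) : μ.real (Ico 0 ℓ) = ArovGauge.cumul μ 0 ℓ :=
    measureReal_congr Ico_ae_eq_Ioc
  have hcumul_pos (ℓ : ℝ) (hℓ : 0 < ℓ) : 0 < ArovGauge.cumul μ 0 ℓ := by
    rw [← hcumul]
    exact ENNReal.toReal_pos (hpos ℓ hℓ).ne' measure_Ico_lt_top.ne
  simp only [hcumul] at hLeb
  rcases (Icc δ (Real.pi - δ)).eq_empty_or_nonempty with hempty | hne
  · simp [hempty]
  have hsin : 0 < Real.sin δ := Real.sin_pos_of_pos_of_lt_pi hδ (by linarith [nonempty_Icc.1 hne])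
  refine (ArovGauge.tendsto_schurLimit hparam hcumul_pos h𝔄 hs hLeb hsin).mono_left ?_
  gcongr with z
  exact ArovGauge.sin_mul_norm_le_im hδ

theorem theorem4p1 (μ : Measure ℝ) (a : ℝ → ℂ)
    (hparam : ArovGauge.IsParameters μ a)
    (hpos : ∀ ℓ : ℝ, 0 < ℓ → 0 < μ (Ico 0 ℓ))
    (𝔄 : ℂ → ℝ → Matrix (Fin 2) (Fin 2) ℂ)
    (h𝔄 : ArovGauge.IsTransferMatrix μ a 𝔄)
    (s : ℂ → ℂ) (hs : ArovGauge.IsSchurFunction 𝔄 s)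
    (a₀ : ℂ)
    (hLeb : Tendsto (fun ℓ : ℝ => (μ.real (Ico 0 ℓ))⁻¹ * ∫ l in (0 : ℝ)..ℓ, ‖a l - a₀‖ ∂μ)
      (𝓝[>] 0) (𝓝 0))
    (δ : ℝ) (hδ : 0 < δ) :
    Tendsto s (Bornology.cobounded ℂ ⊓ 𝓟 {z : ℂ | z.arg ∈ Icc δ (Real.pi - δ)})
      (𝓝 (a₀ / (1 + (Real.sqrt (1 - ‖a₀‖ ^ 2) : ℂ)))) :=
  theorem4p1_general μ a hparam hpos 𝔄 h𝔄 s
    (fun z hz => mem_iInter₂.1 ((hs z hz).symm ▸ mem_singleton (s z))) a₀ hLeb δ hδ
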